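/- All rings are commutative with identity. A ring $A$ is called \emph{purified} if for any two distinct minimal prime ideals $\mathfrak{p}$ and $\mathfrak{q}$ of $A$ there exists an idempotent $e\in A$ such that $e\in\mathfrak{p}$ and $1-e\in\mathfrak{q}$. Let $(R_i)_{i\in I}$ be an arbitrary family of rings. Then the direct product $\prod_{i\in I}R_i$ is a reduced purified ring if and only if $R_i$ is a reduced purified ring for every $i\in I$. -/

import Mathlib

/-- A commutative ring `A` is purified if for any two distinct minimal prime ideals `p` and `q`
of `A` there is an idempotent `e` of `A` with `e ∈ p` and `1 - e ∈ q`. -/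
def IsPurifiedRing (A : Type*) [CommRing A] : Prop :=
  ∀ p ∈ minimalPrimes A, ∀ q ∈ minimalPrimes A, p ≠ q →
    ∃ e : A, IsIdempotentElem e ∧ e ∈ p ∧ 1 - e ∈ q

/-! Minimal primes of an infinite product are hard to describe. For reduced rings, purity is
therefore traded for the elementwise `AnnihilatorsIdempotentGenerated`, which passes to products by
choosing an idempotent in each factor. The equivalence rests on minimal primes avoiding suitable
multiplicative sets. -/

/-- Whenever `f * g = 0`, the element `g` lies in an ideal generated by an idempotent
annihilating `f`. -/
def AnnihilatorsIdempotentGenerated (A : Type*) [CommRing A] : Prop :=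
  ∀ f g : A, f * g = 0 → ∃ e : A, IsIdempotentElem e ∧ e * f = 0 ∧ (1 - e) * g = 0

/-- A submonoid without zero is disjoint from some minimal prime. -/
theorem Submonoid.exists_minimalPrimes_disjoint {A : Type*} [CommRing A] (S : Submonoid A)
    (hS : (0 : A) ∉ S) : ∃ p ∈ minimalPrimes A, ∀ x ∈ S, x ∉ p := by
  have hd : Disjoint ((⊥ : Ideal A) : Set A) (S : Set A) := by
    rw [Set.disjoint_left]
    rintro x hx hxS
    rw [SetLike.mem_coe, Ideal.mem_bot] at hx
    exact hS (hx ▸ hxS)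
  obtain ⟨P, hP, -, hPS⟩ := Ideal.exists_le_prime_disjoint (⊥ : Ideal A) S hd
  obtain ⟨p, hp, hpP⟩ := Ideal.exists_minimalPrimes_le (bot_le : ⊥ ≤ P)
  exact ⟨p, hp, fun x hx hxp => Set.disjoint_left.mp hPS (hpP hxp) hx⟩

theorem eq_zero_of_pow_mul_idempotent {A : Type*} [CommRing A] [IsReduced A] {f e : A} {n : ℕ}
    (he : IsIdempotentElem e) (h : f ^ n * e = 0) : e * f = 0 := by
  have : (e * f) ^ (n + 1) = 0 := by
    rw [mul_pow, he.pow_succ_eq, pow_succ]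
    linear_combination f * h
  exact eq_zero_of_pow_eq_zero this

/-- If no idempotent in `S` annihilates `f`, some minimal prime avoids both `f` and `S`. -/
theorem exists_minimalPrimes_notMem_of_idempotents {A : Type*} [CommRing A] [IsReduced A]
    (f : A) (S : Submonoid A) (hS : ∀ e ∈ S, IsIdempotentElem e) (h : ∀ e ∈ S, e * f ≠ 0) :
    ∃ p ∈ minimalPrimes A, f ∉ p ∧ ∀ e ∈ S, e ∉ p := by
  obtain ⟨p, hp, hd⟩ := (Submonoid.powers f ⊔ S).exists_minimalPrimes_disjoint (by
    intro h0
    obtain ⟨_, ⟨n, rfl⟩, e, he, hz⟩ := Submonoid.mem_sup.mp h0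
    exact h e he (eq_zero_of_pow_mul_idempotent (hS e he) hz))
  exact ⟨p, hp, hd f (Submonoid.mem_sup_left (Submonoid.mem_powers f)),
    fun e he => hd e (Submonoid.mem_sup_right he)⟩

/-- Otherwise some minimal prime `p` avoids `f` and all idempotents outside `q`; but the idempotent
separating `p` from `q` is in `p` and outside `q`. -/
theorem IsPurifiedRing.exists_idempotent_notMem {A : Type*} [CommRing A] [IsReduced A]
    (hA : IsPurifiedRing A) {f : A} {q : Ideal A} (hq : q ∈ minimalPrimes A) (hf : f ∈ q) :
    ∃ e : A, IsIdempotentElem e ∧ e ∉ q ∧ e * f = 0 := by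
  have hqp : q.IsPrime := hq.1.1
  by_contra! hcon
  let S : Submonoid A :=
    { carrier := {e | IsIdempotentElem e ∧ e ∉ q}
      one_mem' := ⟨IsIdempotentElem.one, hqp.one_notMem⟩
      mul_mem' := fun ha hb => ⟨ha.1.mul hb.1, hqp.mul_notMem ha.2 hb.2⟩ }
  obtain ⟨p, hp, hfp, hS⟩ := exists_minimalPrimes_notMem_of_idempotents f S (fun e he => he.1)
    (fun e he => hcon e he.1 he.2)
  obtain ⟨e, he, hep, heq⟩ := hA p hp q hq (fun h => hfp (h ▸ hf))
  refine hS e ⟨he, fun h => hqp.one_notMem ?_⟩ hep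
  simpa using q.add_mem heq h

theorem IsPurifiedRing.annihilatorsIdempotentGenerated {A : Type*} [CommRing A] [IsReduced A]
    (hA : IsPurifiedRing A) : AnnihilatorsIdempotentGenerated A := by
  intro f g hfg
  by_contra! hcon
  let S : Submonoid A :=
    { carrier := {e | IsIdempotentElem e ∧ (1 - e) * f = 0}
      one_mem' := ⟨IsIdempotentElem.one, by simp⟩
      mul_mem' := fun {a b} ha hb => ⟨ha.1.mul hb.1, by
        linear_combination ha.2 + a * hb.2⟩ }
  obtain ⟨q, hq, hgq, hS⟩ := exists_minimalPrimes_notMem_of_idempotents g S (fun e he => he.1)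
    (fun e he => by simpa using hcon (1 - e) he.1.one_sub he.2)
  have hqp : q.IsPrime := hq.1.1
  have hfq : f ∈ q := (hqp.mem_or_mem (hfg ▸ q.zero_mem : f * g ∈ q)).resolve_right hgq
  obtain ⟨e, he, heq, hef⟩ := hA.exists_idempotent_notMem hq hfq
  refine hS (1 - e) ⟨he.one_sub, by simpa using hef⟩ ?_
  refine (hqp.mem_or_mem (?_ : e * (1 - e) ∈ q)).resolve_left heq
  rw [he.mul_one_sub_self]
  exact q.zero_mem

theorem AnnihilatorsIdempotentGenerated.isPurifiedRing {A : Type*} [CommRing A] [IsReduced A]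
    (hA : AnnihilatorsIdempotentGenerated A) : IsPurifiedRing A := by
  intro p hp q hq hpq
  have hpp : p.IsPrime := hp.1.1
  have hqp : q.IsPrime := hq.1.1
  obtain ⟨f, hfp, hfq⟩ := SetLike.not_le_iff_exists.mp
    (fun h : p ≤ q => hpq (le_antisymm h (hq.2 ⟨hpp, bot_le⟩ h)))
  -- By minimality of `p`, `f` is nilpotent in the localization at `p`.
  obtain ⟨g, hgp, n, hn⟩ : ∃ g ∉ p, ∃ n : ℕ, f ^ n * g = 0 := by
    by_contra! hcon
    obtain ⟨p', hp', hd⟩ := (Submonoid.powers f ⊔ p.primeCompl).exists_minimalPrimes_disjoint (by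
      intro h0
      obtain ⟨_, ⟨n, rfl⟩, g, hg, hz⟩ := Submonoid.mem_sup.mp h0
      exact hcon g hg n hz)
    have hle : p' ≤ p := fun x hx => by
      by_contra hxp
      exact hd x (Submonoid.mem_sup_right hxp) hx
    exact hd f (Submonoid.mem_sup_left (Submonoid.mem_powers f)) (hp.2 hp'.1 hle hfp)
  have hfg : f * g = 0 := by
    refine eq_zero_of_pow_eq_zero (n := n + 1) ?_
    rw [mul_pow, pow_succ, pow_succ]
    linear_combination f * g ^ n * hn
  obtain ⟨e, he, hef, heg⟩ := hA f g hfg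
  exact ⟨1 - e, he.one_sub,
    (hpp.mem_or_mem (heg ▸ p.zero_mem : (1 - e) * g ∈ p)).resolve_right hgp, by
    simpa using (hqp.mem_or_mem (hef ▸ q.zero_mem : e * f ∈ q)).resolve_right hfq⟩

theorem isPurifiedRing_iff_annihilatorsIdempotentGenerated {A : Type*} [CommRing A]
    [IsReduced A] : IsPurifiedRing A ↔ AnnihilatorsIdempotentGenerated A :=
  ⟨fun h => h.annihilatorsIdempotentGenerated, fun h => h.isPurifiedRing⟩

theorem annihilatorsIdempotentGenerated_pi_iff {ι : Type*} (R : ι → Type*)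
    [∀ i, CommRing (R i)] :
    AnnihilatorsIdempotentGenerated (∀ i, R i) ↔
      ∀ i, AnnihilatorsIdempotentGenerated (R i) := by
  classical
  constructor
  · intro h i f g hfg
    obtain ⟨e, he, hef, heg⟩ := h (Pi.single i f) (Pi.single i g) (by
      rw [← Pi.single_mul, hfg, Pi.single_zero])
    exact ⟨e i, congrFun he i, by simpa using congrFun hef i, by simpa using congrFun heg i⟩
  · intro h f g hfg
    choose e he hef heg using fun i => h i (f i) (g i) (congrFun hfg i)
    exact ⟨e, funext he, funext hef, funext heg⟩

theorem isReduced_pi_iff {ι : Type*} (R : ι → Type*) [∀ i, CommRing (R i)] :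
    IsReduced (∀ i, R i) ↔ ∀ i, IsReduced (R i) := by
  classical
  refine ⟨fun h i => ⟨fun x ⟨n, hn⟩ => ?_⟩, fun h => inferInstance⟩
  -- If `n = 0`, the power `n` would be `1` in the other coordinates.
  have : (Pi.single i x : ∀ i, R i) ^ (n + 1) = 0 := by
    funext j
    rcases eq_or_ne j i with rfl | hj
    · simp [pow_succ, hn]
    · simp [hj]
  simpa using congrFun (eq_zero_of_pow_eq_zero this) i

theorem mainTheorem12 {ι : Type*} (R : ι → Type*) [∀ i, CommRing (R i)] :
    (IsReduced (∀ i, R i) ∧ IsPurifiedRing (∀ i, R i)) ↔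
      ∀ i, IsReduced (R i) ∧ IsPurifiedRing (R i) := by
  rw [forall_and, ← isReduced_pi_iff]
  refine and_congr_right fun hred => ?_
  have := (isReduced_pi_iff R).mp hred
  simp only [isPurifiedRing_iff_annihilatorsIdempotentGenerated]
  exact annihilatorsIdempotentGenerated_pi_iff R
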